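/- **Theorem B.** Let $n\ge 1$, let $T_n$ be the complete binary rooted tree of height $n$ with leaves $1,\dots,2^n$ numbered from left to right, and let $W_n=\mathrm{Aut}(T_n)$, viewed as a group of permutations of the leaves (composed from right to left). For $1\le i\le n$ let $a_i=\prod_{j=1}^{2^{i-1}}(j,\,j+2^{i-1})\in W_n$ and, for $0\le i\le n$, $x_i=a_1a_2\cdots a_i$. Put $v_i=x_{i+2}^2$ for $0\le i\le n-3$, and $m_1=\mathrm{id}$, $m_n=a_{n-1}x_{n-2}^{x_n}$ for $n\ge 2$, where $g^h=hgh^{-1}$ (so $m_2=(1,2)$). Let $$M_n=\langle x_n,\,m_n,\,v_{n-3},\dots,v_0\rangle\le W_n$$ (so $M_1=\langle(1,2)\rangle$ and $M_2=\langle(1,3,2,4),(1,2)\rangle$). A *datum* of level $n$ is a pair $\bigl(\prod_i[t_i,d_i],r\bigr)$ consisting of a formal commutative product of symbols $[t_i,d_i]$ with types $t_i\in\{nn,ns,sn,ss\}$ and degrees $d_i\geq 1$ with $\sum_i d_i=2^n$, and a density $r\in[0,1]$. *Model 3* has the level $1$ data $$([nn,2],\tfrac14),\quad([ss,2],\tfrac14),\quad([nn,1][nn,1],\tfrac18),\quad([ss,1][ss,1],\tfrac18),\quad([ns,1][sn,1],\tfrac14),$$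 and its level $n+1$ data arise from its level $n$ data by replacing, in each datum, all factors independently of each other according to the transitions $$[nn,d]\to[nn,2d],\qquad [ns,d]\to[ss,2d],\qquad [sn,d]\to[nn,d][ss,d],\qquad [ss,d]\to[nn,d][nn,d]\ \text{or}\ [ss,d][ss,d],$$ where the two alternatives for $[ss,d]$ have probability $\tfrac12$ each; the density of a datum is multiplied by the probabilities of the transitions made. The level $n$ *cycle data* of Model 3 is the set of pairs $(c,q)$, where $c$ is a partition of $2^n$ that occurs as the multiset of degrees of some level $n$ datum and $q$ is the sum of the densities of all level $n$ data with this multiset of degrees. The *cycle data* of $M_n$ is the set of pairs $(c,q)$, where $c$ is the cycle type ($1$-cycles included) of some element of $M_n$ and $q$ is the proportion of elements of $M_n$ with cycle type $c$. Then, for every $n\ge 1$, the cycle data of $M_n$ equals the level $n$ cycle data of Model 3. -/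

import Mathlib

namespace MarkovModel

noncomputable section

open Equiv

/-! ### The tree and its automorphism group -/

/-- `Aut(T_n)` in its faithful action on the `2 ^ n` leaves of the complete binary rooted tree `T_n`
of height `n`. The leaves are `0, …, 2 ^ n - 1` from left to right, and `i`, `j` have the same
ancestor `k` levels above them iff `i / 2 ^ k = j / 2 ^ k`. -/
def treeAut (n : ℕ) : Subgroup (Perm (Fin (2 ^ n))) where
  carrier := {g | ∀ (k : ℕ) (i j : Fin (2 ^ n)),
    (g i : ℕ) / 2 ^ k = (g j : ℕ) / 2 ^ k ↔ (i : ℕ) / 2 ^ k = (j : ℕ) / 2 ^ k}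
  one_mem' := fun _ _ _ => Iff.rfl
  mul_mem' := fun hg hh k i j => (hg k _ _).trans (hh k i j)
  inv_mem' := fun {g} hg k i j => by simpa using (hg k (g⁻¹ i) (g⁻¹ j)).symm

/-- Exchange `[0, h)` with `[h, 2h)` by translation by `h`, and fix everything else. -/
def swapHalves (h j : ℕ) : ℕ :=
  if j < h then j + h else if j < 2 * h then j - h else j

theorem swapHalves_swapHalves (h j : ℕ) : swapHalves h (swapHalves h j) = j := by
  unfold swapHalves; split_ifs <;> omega

theorem swapHalves_lt {n i j : ℕ} (hi : i < n) (hj : j < 2 ^ n) : swapHalves (2 ^ i) j < 2 ^ n := by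
  have h : 2 * 2 ^ i ≤ 2 ^ n := by
    rw [← pow_succ']; exact Nat.pow_le_pow_right (by norm_num) hi
  unfold swapHalves; split_ifs <;> omega

/-- The generator `a_i`, `1 ≤ i ≤ n`, of `Aut(T_n)`: the product of the transpositions
`(j, j + 2 ^ (i - 1))` over the first `2 ^ (i - 1)` leaves `j`. (The value is `1` for other `i`.) -/
def a (n i : ℕ) : Perm (Fin (2 ^ n)) :=
  if hi : 1 ≤ i ∧ i ≤ n then
    Function.Involutive.toPerm
      (fun j => ⟨swapHalves (2 ^ (i - 1)) j, swapHalves_lt (by omega) j.isLt⟩)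
      (fun j => Fin.ext (swapHalves_swapHalves (2 ^ (i - 1)) j))
  else 1

/-- `x_i = a_1 a_2 ⋯ a_i` (the standard `i`-odometer), regarded as an element of `Aut(T_n)`;
products of permutations are composed from right to left. -/
def x (n i : ℕ) : Perm (Fin (2 ^ n)) :=
  ((List.range i).map fun k => a n (k + 1)).prod

/-- `m_1 = id` and `m_n = a_{n-1} x_{n-2}^{x_n}` for `n ≥ 2`, where `g ^ h = h g h⁻¹`.
As `x_0 = id`, this gives `m_2 = a_1`. -/
def m : (n : ℕ) → Perm (Fin (2 ^ n))
  | 0 => 1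
  | 1 => 1
  | n + 2 => a (n + 2) (n + 1) * (x (n + 2) (n + 2) * x (n + 2) n * (x (n + 2) (n + 2))⁻¹)

/-- `v_i = x_{i+2}²`, regarded as an element of `Aut(T_n)`. -/
def v (n i : ℕ) : Perm (Fin (2 ^ n)) := x n (i + 2) ^ 2

/-- `M_n = ⟨x_n, m_n, v_{n-3}, …, v_0⟩`. -/
def M (n : ℕ) : Subgroup (Perm (Fin (2 ^ n))) :=
  Subgroup.closure ({x n n, m n} ∪ {g | ∃ i, i + 3 ≤ n ∧ g = v n i})

/-! ### Cycle data -/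

/-- The cycle type of a permutation, `1`-cycles included. -/
def cycles {n : ℕ} (g : Perm (Fin (2 ^ n))) : Multiset ℕ := g.partition.parts

/-- The cycle data of `S₁` relative to `S₂`: all pairs `(c, p_c |S₁| / |S₂|)`, where `c` is a cycle
type that occurs in `S₁` and `p_c` is the proportion of elements of `S₁` of cycle type `c`. -/
def cycleData {n : ℕ} (S₁ S₂ : Set (Perm (Fin (2 ^ n)))) : Set (Multiset ℕ × ℚ) :=
  {p | ∃ g ∈ S₁, p.1 = cycles g ∧
    p.2 = ({h ∈ S₁ | cycles h = cycles g}.ncard / S₁.ncard : ℚ) * (S₁.ncard / S₂.ncard : ℚ)}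

/-! ### The Markov process of Model 3 -/

/-- The types `nn`, `ns`, `sn`, `ss`. -/
inductive FactorType
  | nn | ns | sn | ss

/-- A formal factor `[t, d]`: a type `t` and a degree `d`. -/
abbrev Factor := FactorType × ℕ

/-- A formal (commutative) product `∏ [t_i, d_i]`. -/
abbrev FormalProduct := Multiset Factor

/-- A collection of data `(F, r)`, where data with the same formal product are combined:
a finitely supported assignment of densities to formal products. Data are written
`single F r`, and `single F r * single G s = single (F + G) (r * s)`: juxtaposition of formal
products, with densities multiplied, so that products describe independent choices. -/
abbrev LevelData := AddMonoidAlgebra ℚ FormalProduct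

/-- The possible results of one transition from a single factor. -/
def transitions : Factor → List FormalProduct
  | (.nn, d) => [{(.nn, 2 * d)}]
  | (.ns, d) => [{(.ss, 2 * d)}]
  | (.sn, d) => [{(.nn, d), (.ss, d)}]
  | (.ss, d) => [{(.nn, d), (.nn, d)}, {(.ss, d), (.ss, d)}]

/-- One transition from a single factor: all possible results are equiprobable. -/
def stepFactor (f : Factor) : LevelData :=
  ((transitions f).map fun F =>
    AddMonoidAlgebra.single F (1 / ((transitions f).length : ℚ))).sum

/-- One application of the Markov process: in each datum `(F, r)` the factors of `F` make their
transitions independently of each other. -/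
def step (D : LevelData) : LevelData :=
  D.coeff.sum fun F r => r • (F.map stepFactor).prod

/-- The level `1` data of Model 3. -/
def levelOne : LevelData :=
  .single {(.nn, 2)} (1 / 4) + .single {(.ss, 2)} (1 / 4) +
    .single {(.nn, 1), (.nn, 1)} (1 / 8) + .single {(.ss, 1), (.ss, 1)} (1 / 8) +
    .single {(.ns, 1), (.sn, 1)} (1 / 4)

/-- The level `n` data of Model 3, for `n ≥ 1`. -/
def levelData (n : ℕ) : LevelData := step^[n - 1] levelOne

/-- The partition underlying a formal product. -/
def degrees (F : FormalProduct) : Multiset ℕ := F.map Prod.snd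

/-- The cycle data of a collection of data: the partitions that occur, each with the sum of the
densities of all data with that partition. -/
def LevelData.toCycleData (D : LevelData) : Set (Multiset ℕ × ℚ) :=
  {p | ∃ F ∈ D.coeff.support, p.1 = degrees F ∧
    p.2 = ∑ G ∈ D.coeff.support with degrees G = degrees F, D.coeff G}

end

end MarkovModel

namespace MarkovModel

noncomputable section

open Equiv

/-! ### Cycle types and minimal periods -/

/-! Distributions of permutations are treated as elements of the rational group algebra.
Automorphisms of T_{n+1} are pairs acting on the two halves, possibly followed by their exchange, so
distributions are assembled from `tens A B` (independent choices on the halves) and `swapEl`. The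
recursion `dist` attaches a distribution to each factor type, and `distM n` is a combination of
products of these.

`distM n` is uniform on M_{n+1}. Left multiplication by x_n and a_n permutes the four `dist n t`,
and the v_i fix them; hence the generators fix `distM n` (`el_mul_distM`). Moreover it is supported
in M_{n+1} (`distM_mem_supportedIn`) and has mass 1. This determines it (`coeff_distM`), without
computing the order of M_{n+1}.

Its cycle types follow Model 3. A pair (g, h) has the union of the two cycle types, while (g, h)
times the exchange has the cycle type of gh with all lengths doubled. Since `ss` and `nn` multiply
like the elements of Z/2, the recursion for `dist` becomes the table of transitions and `distM`
becomes the level 1 data (`cyc_distM`). Induction on the number of steps (`evolve_factorDatum`)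
matches the process with the tree, read from the root downwards. Densities are nonnegative, so
partitions that occur cannot cancel. -/

theorem minimalPeriod_eq_card_support_cycleOf {α : Type*} [Fintype α] [DecidableEq α]
    (f : Perm α) {y : α} (hy : f y ≠ y) :
    Function.minimalPeriod f y = (f.cycleOf y).support.card := by
  have hc : (f.cycleOf y).IsCycle := Perm.isCycle_cycleOf f hy
  have key : ∀ k : ℕ, Function.minimalPeriod f y ∣ k ↔ (f.cycleOf y).support.card ∣ k := by
    intro k
    rw [← Function.isPeriodicPt_iff_minimalPeriod_dvd, ← hc.orderOf, orderOf_dvd_iff_pow_eq_one,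
      hc.pow_eq_one_iff' (x := y) (by rwa [Perm.cycleOf_apply_self]), Perm.cycleOf_pow_apply_self,
      Function.IsPeriodicPt, Function.IsFixedPt, Perm.iterate_eq_pow]
  exact Nat.dvd_antisymm ((key _).2 dvd_rfl) ((key _).1 dvd_rfl)

/-- Each k-cycle contributes its k points: for k > 1, group the points by `cycleOf`. The case k = 1
is separate because `cycleType` omits fixed points. -/
theorem card_minimalPeriod_eq {α : Type*} [Fintype α] [DecidableEq α] (f : Perm α) (k : ℕ) :
    (Finset.univ.filter fun y => Function.minimalPeriod f y = k).card =
      k * f.partition.parts.count k := by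
  rw [Perm.parts_partition, Multiset.count_add]
  rcases Nat.lt_trichotomy k 1 with hk | rfl | hk
  · obtain rfl : k = 0 := by omega
    rw [zero_mul, Finset.card_eq_zero, Finset.filter_eq_empty_iff]
    intro y _
    exact (Function.minimalPeriod_pos_of_mem_periodicPts
      (Function.Injective.mem_periodicPts f.injective y)).ne'
  · have h1 : f.cycleType.count 1 = 0 :=
      Multiset.count_eq_zero.2 fun h => absurd (Perm.one_lt_of_mem_cycleType h) (lt_irrefl 1)
    rw [h1, Multiset.count_replicate_self, zero_add, one_mul, ← Finset.card_compl]
    congr 1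
    ext y
    simp [Function.minimalPeriod_eq_one_iff_isFixedPt, Function.IsFixedPt]
  · rw [Multiset.count_replicate, if_neg (by omega), add_zero, Perm.cycleType_def,
      Multiset.count_map]
    have hmem : ∀ y ∈ Finset.univ.filter (fun y => Function.minimalPeriod f y = k),
        f.cycleOf y ∈ f.cycleFactorsFinset.filter (fun c => k = c.support.card) := by
      intro y hy
      rw [Finset.mem_filter] at hy
      have hne : f y ≠ y := by
        intro h
        have := Function.minimalPeriod_eq_one_iff_isFixedPt.2 h
        omega
      rw [Finset.mem_filter, Perm.cycleOf_mem_cycleFactorsFinset_iff, Perm.mem_support]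
      exact ⟨hne, by rw [← minimalPeriod_eq_card_support_cycleOf f hne, hy.2]⟩
    rw [Finset.card_eq_sum_card_fiberwise (t := f.cycleFactorsFinset.filter
      (fun c => k = c.support.card)) (f := fun y => f.cycleOf y) hmem]
    have hfib : ∀ c ∈ f.cycleFactorsFinset.filter (fun c => k = c.support.card),
        (Finset.filter (fun y => f.cycleOf y = c)
          (Finset.univ.filter (fun y => Function.minimalPeriod f y = k))).card = k := by
      intro c hc
      rw [Finset.mem_filter] at hc
      conv_rhs => rw [hc.2]
      congr 1
      ext y
      simp only [Finset.mem_filter, Finset.mem_univ, true_and]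
      constructor
      · rintro ⟨h1, rfl⟩
        rw [Perm.mem_support, Perm.cycleOf_apply_self]
        intro h
        have := Function.minimalPeriod_eq_one_iff_isFixedPt.2 h
        omega
      · intro hy
        have h := Perm.cycle_is_cycleOf hy hc.1
        have hne : f y ≠ y := by
          have := Perm.mem_cycleFactorsFinset_support_le hc.1 hy
          rwa [Perm.mem_support] at this
        exact ⟨by rw [minimalPeriod_eq_card_support_cycleOf f hne, ← h, ← hc.2], h.symm⟩
    rw [Finset.sum_congr rfl hfib, Finset.sum_const, smul_eq_mul, mul_comm]
    rfl

theorem zero_notMem_parts_partition {α : Type*} [Fintype α] [DecidableEq α] (f : Perm α) :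
    f.partition.parts.count 0 = 0 :=
  Multiset.count_eq_zero.2 fun h => (f.partition.parts_pos h).ne' rfl

/-- The cycle type is determined by the numbers of points of given minimal period. -/
theorem parts_partition_eq {α : Type*} [Fintype α] [DecidableEq α] (f : Perm α) {s : Multiset ℕ}
    (h0 : s.count 0 = 0)
    (h : ∀ k, (Finset.univ.filter fun y => Function.minimalPeriod f y = k).card = k * s.count k) :
    f.partition.parts = s := by
  ext k
  rcases Nat.eq_zero_or_pos k with rfl | hk
  · rw [h0, zero_notMem_parts_partition]
  · exact Nat.eq_of_mul_eq_mul_left hk ((card_minimalPeriod_eq f k).symm.trans (h k))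

/-! ### The two halves of the tree -/

/-- The leaves of `T_{n+1}` as the disjoint union of the leaves of its left and right halves. -/
def leafEquiv (n : ℕ) : Fin (2 ^ n) ⊕ Fin (2 ^ n) ≃ Fin (2 ^ (n + 1)) :=
  finSumFinEquiv.trans (finCongr (by rw [pow_succ]; omega))

theorem leafEquiv_inl (n : ℕ) (i : Fin (2 ^ n)) : (leafEquiv n (.inl i) : ℕ) = i := by
  simp [leafEquiv]

theorem leafEquiv_inr (n : ℕ) (i : Fin (2 ^ n)) : (leafEquiv n (.inr i) : ℕ) = 2 ^ n + i := by
  simp [leafEquiv, add_comm]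

/-- The action of a pair of permutations on the two halves. -/
def pairHom (n : ℕ) : Perm (Fin (2 ^ n)) × Perm (Fin (2 ^ n)) →* Perm (Fin (2 ^ (n + 1))) :=
  ((leafEquiv n).permCongrHom : _ →* _).comp (Perm.sumCongrHom _ _)

/-- The action on the left half. -/
def inL (n : ℕ) : Perm (Fin (2 ^ n)) →* Perm (Fin (2 ^ (n + 1))) :=
  (pairHom n).comp (MonoidHom.inl _ _)

/-- The action on the right half. -/
def inR (n : ℕ) : Perm (Fin (2 ^ n)) →* Perm (Fin (2 ^ (n + 1))) :=
  (pairHom n).comp (MonoidHom.inr _ _)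

@[simp]
theorem inL_apply_inl (n : ℕ) (g : Perm (Fin (2 ^ n))) (i : Fin (2 ^ n)) :
    inL n g (leafEquiv n (.inl i)) = leafEquiv n (.inl (g i)) := by
  simp [inL, pairHom, Equiv.permCongrHom]

@[simp]
theorem inL_apply_inr (n : ℕ) (g : Perm (Fin (2 ^ n))) (i : Fin (2 ^ n)) :
    inL n g (leafEquiv n (.inr i)) = leafEquiv n (.inr i) := by
  simp [inL, pairHom, Equiv.permCongrHom]

@[simp]
theorem inR_apply_inl (n : ℕ) (g : Perm (Fin (2 ^ n))) (i : Fin (2 ^ n)) :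
    inR n g (leafEquiv n (.inl i)) = leafEquiv n (.inl i) := by
  simp [inR, pairHom, Equiv.permCongrHom]

@[simp]
theorem inR_apply_inr (n : ℕ) (g : Perm (Fin (2 ^ n))) (i : Fin (2 ^ n)) :
    inR n g (leafEquiv n (.inr i)) = leafEquiv n (.inr (g i)) := by
  simp [inR, pairHom, Equiv.permCongrHom]

theorem a_apply_of_le {n i : ℕ} (h1 : 1 ≤ i) (hi : i ≤ n) (j : Fin (2 ^ n)) :
    (a n i j : ℕ) = swapHalves (2 ^ (i - 1)) j := by
  rw [a, dif_pos ⟨h1, hi⟩]; rfl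

@[simp]
theorem a_top_apply_inl (n : ℕ) (i : Fin (2 ^ n)) :
    a (n + 1) (n + 1) (leafEquiv n (.inl i)) = leafEquiv n (.inr i) := by
  have := i.isLt
  apply Fin.ext
  rw [a_apply_of_le (by omega) le_rfl, leafEquiv_inl, leafEquiv_inr, Nat.add_sub_cancel,
    swapHalves, if_pos this, add_comm]

@[simp]
theorem a_top_apply_inr (n : ℕ) (i : Fin (2 ^ n)) :
    a (n + 1) (n + 1) (leafEquiv n (.inr i)) = leafEquiv n (.inl i) := by
  have := i.isLt
  apply Fin.ext
  rw [a_apply_of_le (by omega) le_rfl, leafEquiv_inl, leafEquiv_inr, Nat.add_sub_cancel,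
    swapHalves, if_neg (by omega), if_pos (by omega), Nat.add_sub_cancel_left]

theorem perm_ext_leafEquiv {n : ℕ} {f g : Perm (Fin (2 ^ (n + 1)))}
    (hl : ∀ i, f (leafEquiv n (.inl i)) = g (leafEquiv n (.inl i)))
    (hr : ∀ i, f (leafEquiv n (.inr i)) = g (leafEquiv n (.inr i))) : f = g := by
  apply Equiv.ext
  intro y
  obtain ⟨i | i, rfl⟩ := (leafEquiv n).surjective y
  exacts [hl i, hr i]

theorem a_top_mul_self (n : ℕ) : a (n + 1) (n + 1) * a (n + 1) (n + 1) = 1 :=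
  perm_ext_leafEquiv (by simp) (by simp)

theorem a_top_mul_inL (n : ℕ) (g : Perm (Fin (2 ^ n))) :
    a (n + 1) (n + 1) * inL n g = inR n g * a (n + 1) (n + 1) :=
  perm_ext_leafEquiv (by simp) (by simp)

theorem a_top_mul_inR (n : ℕ) (g : Perm (Fin (2 ^ n))) :
    a (n + 1) (n + 1) * inR n g = inL n g * a (n + 1) (n + 1) :=
  perm_ext_leafEquiv (by simp) (by simp)

theorem inR_mul_inL (n : ℕ) (g h : Perm (Fin (2 ^ n))) :
    inR n h * inL n g = inL n g * inR n h :=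
  perm_ext_leafEquiv (by simp) (by simp)

theorem a_succ {n i : ℕ} (hi : i ≤ n) : a (n + 1) i = inL n (a n i) := by
  rcases Nat.eq_zero_or_pos i with rfl | h1
  · simp [a]
  have h2 : 2 * 2 ^ (i - 1) ≤ 2 ^ n := by
    rw [← pow_succ']; exact Nat.pow_le_pow_right (by norm_num) (by omega)
  refine perm_ext_leafEquiv (fun j => Fin.ext ?_) (fun j => Fin.ext ?_)
  · rw [inL_apply_inl, leafEquiv_inl, a_apply_of_le h1 hi, a_apply_of_le h1 (by omega),
      leafEquiv_inl]
  · rw [inL_apply_inr, a_apply_of_le h1 (by omega), leafEquiv_inr, swapHalves, if_neg (by omega),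
      if_neg (by omega)]

theorem x_succ_right (n i : ℕ) : x n (i + 1) = x n i * a n (i + 1) := by
  simp [x, List.range_succ]

theorem x_succ {n i : ℕ} (hi : i ≤ n) : x (n + 1) i = inL n (x n i) := by
  induction i with
  | zero => simp [x]
  | succ i ih => rw [x_succ_right, x_succ_right, ih (by omega), a_succ hi, map_mul]

theorem x_top (n : ℕ) : x (n + 1) (n + 1) = inL n (x n n) * a (n + 1) (n + 1) := by
  rw [x_succ_right, x_succ le_rfl]

theorem x_top_mul_a_top (n : ℕ) : x (n + 1) (n + 1) * a (n + 1) (n + 1) = inL n (x n n) := by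
  rw [x_top, mul_assoc, a_top_mul_self, mul_one]

theorem v_succ {n i : ℕ} (hi : i + 2 ≤ n) : v (n + 1) i = inL n (v n i) := by
  rw [v, v, x_succ hi, map_pow]

theorem x_top_sq (n : ℕ) : x (n + 1) (n + 1) ^ 2 = inL n (x n n) * inR n (x n n) := by
  rw [x_top, sq, mul_assoc, ← mul_assoc (a _ _), a_top_mul_inL, mul_assoc, a_top_mul_self, mul_one]

theorem x_top_mul_inL (n : ℕ) (g : Perm (Fin (2 ^ n))) :
    x (n + 1) (n + 1) * inL n g = inR n g * x (n + 1) (n + 1) := by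
  rw [x_top, mul_assoc, a_top_mul_inL, ← mul_assoc, ← inR_mul_inL, mul_assoc]

/-- Conjugation by the odometer x_{n+1} moves the left-half element x_{n-1} to the right half, and
x_{n-1} = x_n a_n because a_n is an involution. -/
theorem m_succ (n : ℕ) : m (n + 1) = inL n (a n n) * inR n (x n n * a n n) := by
  cases n with
  | zero => simp [m, a, x]
  | succ n =>
    rw [m, a_succ le_rfl, x_succ (by omega : n ≤ n + 1), x_top_mul_inL, mul_assoc (inR _ _),
      mul_inv_cancel, mul_one, x_succ le_rfl, x_top_mul_a_top]

/-! ### Cycle types of elements of the wreath product -/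

theorem card_filter_leafEquiv (n : ℕ) (p : Fin (2 ^ (n + 1)) → Prop) [DecidablePred p] :
    (Finset.univ.filter p).card =
      (Finset.univ.filter fun i => p (leafEquiv n (.inl i))).card +
        (Finset.univ.filter fun i => p (leafEquiv n (.inr i))).card := by
  simp only [Finset.card_filter]
  rw [← (leafEquiv n).sum_comp, Fintype.sum_sum_type]

theorem minimalPeriod_eq_of_semiconj {α β : Type*} {f : α → α} {g : β → β} {φ : α → β}
    (hφ : Function.Injective φ) (h : ∀ y, g (φ y) = φ (f y)) (y : α) :
    Function.minimalPeriod g (φ y) = Function.minimalPeriod f y := by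
  have hs : Function.Semiconj φ f g := fun y => (h y).symm
  rw [Function.minimalPeriod_eq_minimalPeriod_iff]
  intro k
  rw [Function.IsPeriodicPt, Function.IsPeriodicPt, Function.IsFixedPt, Function.IsFixedPt,
    ← (hs.iterate_right k).eq, hφ.eq_iff]

theorem cycles_inL_mul_inR (n : ℕ) (g h : Perm (Fin (2 ^ n))) :
    cycles (inL n g * inR n h) = cycles g + cycles h := by
  refine parts_partition_eq _ ?_ fun k => ?_
  · simp [cycles, zero_notMem_parts_partition, Multiset.count_add]
  have hl : ∀ i, Function.minimalPeriod (inL n g * inR n h) (leafEquiv n (.inl i)) =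
      Function.minimalPeriod g i :=
    minimalPeriod_eq_of_semiconj (φ := fun i => leafEquiv n (.inl i))
      ((leafEquiv n).injective.comp Sum.inl_injective) (by simp)
  have hr : ∀ i, Function.minimalPeriod (inL n g * inR n h) (leafEquiv n (.inr i)) =
      Function.minimalPeriod h i :=
    minimalPeriod_eq_of_semiconj (φ := fun i => leafEquiv n (.inr i))
      ((leafEquiv n).injective.comp Sum.inr_injective) (by simp)
  rw [card_filter_leafEquiv]
  simp only [hl, hr]
  rw [card_minimalPeriod_eq, card_minimalPeriod_eq, Multiset.count_add, mul_add]
  rfl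

/-- If `f` has no points of odd period in the orbit of `y`, its period is twice that of `f²`. -/
theorem minimalPeriod_eq_two_mul {α : Type*} {f : α → α} {y : α}
    (hodd : ∀ k, ¬ Function.IsPeriodicPt f (2 * k + 1) y) :
    Function.minimalPeriod f y = 2 * Function.minimalPeriod (f^[2]) y := by
  have key : ∀ k, Function.minimalPeriod f y ∣ k ↔ 2 * Function.minimalPeriod (f^[2]) y ∣ k := by
    intro k
    rw [← Function.isPeriodicPt_iff_minimalPeriod_dvd]
    rcases Nat.even_or_odd' k with ⟨k, rfl | rfl⟩
    · rw [Nat.mul_dvd_mul_iff_left two_pos, ← Function.isPeriodicPt_iff_minimalPeriod_dvd,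
        Function.IsPeriodicPt, Function.IsPeriodicPt, ← Function.iterate_mul]
    · exact iff_of_false (hodd k) fun h => by have := (dvd_mul_right 2 _).trans h; omega
  exact Nat.dvd_antisymm ((key _).2 dvd_rfl) ((key _).1 dvd_rfl)

/-- The permutation exchanges the halves, so all periods are even; its square acts by gh on the left
and by the conjugate hg on the right. Each cycle of gh thus yields one cycle of twice the length. -/
theorem cycles_inL_mul_inR_mul_a_top (n : ℕ) (g h : Perm (Fin (2 ^ n))) :
    cycles (inL n g * inR n h * a (n + 1) (n + 1)) = (cycles (g * h)).map (2 * ·) := by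
  set f := inL n g * inR n h * a (n + 1) (n + 1) with hf
  have f_inl : ∀ i, f (leafEquiv n (.inl i)) = leafEquiv n (.inr (h i)) := by simp [hf]
  have f_inr : ∀ i, f (leafEquiv n (.inr i)) = leafEquiv n (.inl (g i)) := by simp [hf]
  have hinl : Function.Injective fun i => leafEquiv n (.inl i) :=
    (leafEquiv n).injective.comp Sum.inl_injective
  have hinr : Function.Injective fun i => leafEquiv n (.inr i) :=
    (leafEquiv n).injective.comp Sum.inr_injective
  have f2_inl : ∀ i, f^[2] (leafEquiv n (.inl i)) = leafEquiv n (.inl ((g * h) i)) := by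
    simp [f_inl, f_inr]
  have f2_inr : ∀ i, f^[2] (leafEquiv n (.inr i)) = leafEquiv n (.inr ((h * g) i)) := by
    simp [f_inl, f_inr]
  have it_inl : ∀ k i, f^[2 * k] (leafEquiv n (.inl i)) =
      leafEquiv n (.inl ((g * h)^[k] i)) := by
    intro k i
    rw [Function.iterate_mul]
    exact ((Function.Semiconj.iterate_right (f := fun i => leafEquiv n (.inl i))
      (fun i => (f2_inl i).symm) k).eq i).symm
  have it_inr : ∀ k i, f^[2 * k] (leafEquiv n (.inr i)) =
      leafEquiv n (.inr ((h * g)^[k] i)) := by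
    intro k i
    rw [Function.iterate_mul]
    exact ((Function.Semiconj.iterate_right (f := fun i => leafEquiv n (.inr i))
      (fun i => (f2_inr i).symm) k).eq i).symm
  have hl : ∀ i, Function.minimalPeriod f (leafEquiv n (.inl i)) =
      2 * Function.minimalPeriod (g * h) i := by
    intro i
    rw [minimalPeriod_eq_two_mul, minimalPeriod_eq_of_semiconj hinl f2_inl i]
    intro k hk
    rw [Function.IsPeriodicPt, Function.IsFixedPt, Function.iterate_succ_apply, f_inl,
      it_inr] at hk
    simpa using (leafEquiv n).injective hk
  -- Here g intertwines hg with gh; evaluating at `g i` lets the right half be reindexed by g in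
  -- `hcount`.
  have hr : ∀ i, Function.minimalPeriod f (leafEquiv n (.inr i)) =
      2 * Function.minimalPeriod (g * h) (g i) := by
    intro i
    rw [minimalPeriod_eq_two_mul, minimalPeriod_eq_of_semiconj hinr f2_inr i,
      minimalPeriod_eq_of_semiconj (f := h * g) g.injective (by simp)]
    intro k hk
    rw [Function.IsPeriodicPt, Function.IsFixedPt, Function.iterate_succ_apply, f_inr,
      it_inl] at hk
    simpa using (leafEquiv n).injective hk
  have hcount : ∀ k, (Finset.univ.filter fun y => Function.minimalPeriod f y = k).card =
      2 * (Finset.univ.filter fun i => 2 * Function.minimalPeriod (g * h) i = k).card := by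
    intro k
    rw [card_filter_leafEquiv, two_mul]
    simp only [hl, hr]
    congr 1
    exact Finset.card_equiv g fun i => by rw [Finset.mem_filter_univ, Finset.mem_filter_univ]
  refine parts_partition_eq _ ?_ fun k => ?_
  · rw [Multiset.count_eq_zero]
    intro h0
    obtain ⟨k, hk, hk0⟩ := Multiset.mem_map.1 h0
    have := (g * h).partition.parts_pos hk
    omega
  · rw [hcount]
    rcases Nat.even_or_odd' k with ⟨k, rfl | rfl⟩
    · rw [Multiset.count_map_eq_count' _ _ (fun _ _ h => by simpa using h)]
      simp only [mul_eq_mul_left_iff, OfNat.ofNat_ne_zero, or_false]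
      rw [card_minimalPeriod_eq, mul_assoc]
      rfl
    · rw [Finset.filter_false_of_mem (by intro i _; omega), Multiset.count_eq_zero.2, mul_zero]
      · simp
      · intro h0
        obtain ⟨j, -, hj⟩ := Multiset.mem_map.1 h0
        omega

/-! ### Tree automorphisms -/

/-- Passing to ancestors k levels up shrinks the exchanged blocks by 2^k; once k > i, both blocks
lie below one ancestor and the exchange becomes invisible. -/
theorem swapHalves_div (i k j : ℕ) :
    swapHalves (2 ^ i) j / 2 ^ k =
      if k ≤ i then swapHalves (2 ^ (i - k)) (j / 2 ^ k) else j / 2 ^ k := by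
  have hk : 0 < 2 ^ k := by positivity
  split_ifs with h
  · have e : 2 ^ i = 2 ^ (i - k) * 2 ^ k := by rw [← pow_add]; congr 1; omega
    unfold swapHalves
    rw [e, ← mul_assoc]
    simp only [← Nat.div_lt_iff_lt_mul hk]
    split_ifs
    · rw [Nat.add_mul_div_right _ _ hk]
    · rw [mul_comm (2 ^ (i - k)), Nat.sub_mul_div]
    · rfl
  · obtain ⟨q, rfl⟩ : ∃ q, k = i + 1 + q := ⟨k - (i + 1), by omega⟩
    have e : 2 ^ (i + 1 + q) = 2 * 2 ^ i * 2 ^ q := by ring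
    have hle : 2 * 2 ^ i ≤ 2 ^ (i + 1 + q) := by
      rw [e]; exact Nat.le_mul_of_pos_right _ (by positivity)
    unfold swapHalves
    split_ifs
    · rw [Nat.div_eq_of_lt (by omega), Nat.div_eq_of_lt (by omega)]
    · rw [Nat.div_eq_of_lt (by omega), Nat.div_eq_of_lt (by omega)]
    · rfl

theorem a_mem_treeAut (n i : ℕ) : a n i ∈ treeAut n := by
  by_cases hi : 1 ≤ i ∧ i ≤ n
  · intro k j j'
    rw [a_apply_of_le hi.1 hi.2, a_apply_of_le hi.1 hi.2, swapHalves_div, swapHalves_div]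
    split_ifs
    · exact (Function.LeftInverse.injective (swapHalves_swapHalves _)).eq_iff
    · rfl
  · rw [a, dif_neg hi]; exact one_mem _

theorem x_mem_treeAut (n i : ℕ) : x n i ∈ treeAut n := by
  induction i with
  | zero => exact one_mem _
  | succ i ih => rw [x_succ_right]; exact mul_mem ih (a_mem_treeAut n _)

theorem m_mem_treeAut (n : ℕ) : m n ∈ treeAut n := by
  match n with
  | 0 => exact one_mem _
  | 1 => exact one_mem _
  | n + 2 =>
    exact mul_mem (a_mem_treeAut _ _) (mul_mem (mul_mem (x_mem_treeAut _ _) (x_mem_treeAut _ _))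
      (inv_mem (x_mem_treeAut _ _)))

theorem M_le_treeAut (n : ℕ) : M n ≤ treeAut n := by
  rw [M, Subgroup.closure_le]
  rintro g ((rfl | rfl) | ⟨i, -, rfl⟩)
  exacts [x_mem_treeAut n n, m_mem_treeAut n, pow_mem (x_mem_treeAut n _) 2]

/-! ### Uniform distributions in the group algebra -/

/-- The rational group algebra of the permutations of the leaves of `T_n`. -/
abbrev GroupAlg (n : ℕ) := MonoidAlgebra ℚ (Perm (Fin (2 ^ n)))

/-- A permutation as an element of the group algebra. -/
abbrev el {n : ℕ} (g : Perm (Fin (2 ^ n))) : GroupAlg n := MonoidAlgebra.of ℚ _ g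

/-- The map of group algebras induced by the action on the left half. -/
def algL (n : ℕ) : GroupAlg n →ₐ[ℚ] GroupAlg (n + 1) := MonoidAlgebra.mapDomainAlgHom ℚ ℚ (inL n)

/-- The map of group algebras induced by the action on the right half. -/
def algR (n : ℕ) : GroupAlg n →ₐ[ℚ] GroupAlg (n + 1) := MonoidAlgebra.mapDomainAlgHom ℚ ℚ (inR n)

theorem algL_el (n : ℕ) (g : Perm (Fin (2 ^ n))) : algL n (el g) = el (inL n g) := by
  simp [algL, el]

theorem algR_el (n : ℕ) (g : Perm (Fin (2 ^ n))) : algR n (el g) = el (inR n g) := by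
  simp [algR, el]

theorem el_one (n : ℕ) : el (1 : Perm (Fin (2 ^ n))) = 1 := map_one _

theorem el_mul {n : ℕ} (g h : Perm (Fin (2 ^ n))) : el (g * h) = el g * el h := map_mul _ g h

theorem groupAlg_induction {n : ℕ} {p : GroupAlg n → Prop} (A : GroupAlg n)
    (hel : ∀ g, p (el g)) (hadd : ∀ A B, p A → p B → p (A + B))
    (hsmul : ∀ (r : ℚ) A, p A → p (r • A)) : p A :=
  MonoidAlgebra.induction_on A hel hadd hsmul

/-- The element of the group algebra given by the exchange of the two halves. -/
def swapEl (n : ℕ) : GroupAlg (n + 1) := el (a (n + 1) (n + 1))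

theorem swapEl_mul_self (n : ℕ) : swapEl n * swapEl n = 1 := by
  rw [swapEl, ← map_mul, a_top_mul_self, map_one]

theorem swapEl_mul_algL (n : ℕ) (A : GroupAlg n) :
    swapEl n * algL n A = algR n A * swapEl n := by
  induction A using groupAlg_induction with
  | hel g => rw [algL_el, algR_el, swapEl, ← map_mul, ← map_mul, a_top_mul_inL]
  | hadd A B hA hB => rw [map_add, map_add, mul_add, add_mul, hA, hB]
  | hsmul r A hA => rw [map_smul, map_smul, mul_smul_comm, smul_mul_assoc, hA]

theorem swapEl_mul_algR (n : ℕ) (A : GroupAlg n) :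
    swapEl n * algR n A = algL n A * swapEl n := by
  induction A using groupAlg_induction with
  | hel g => rw [algL_el, algR_el, swapEl, ← map_mul, ← map_mul, a_top_mul_inR]
  | hadd A B hA hB => rw [map_add, map_add, mul_add, add_mul, hA, hB]
  | hsmul r A hA => rw [map_smul, map_smul, mul_smul_comm, smul_mul_assoc, hA]

theorem algR_mul_algL (n : ℕ) (A B : GroupAlg n) :
    algR n B * algL n A = algL n A * algR n B := by
  induction A using groupAlg_induction with
  | hel g =>
    induction B using groupAlg_induction with
    | hel h => rw [algL_el, algR_el, ← map_mul, ← map_mul, inR_mul_inL]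
    | hadd A B hA hB => rw [map_add, mul_add, add_mul, hA, hB]
    | hsmul r A hA => rw [map_smul, mul_smul_comm, smul_mul_assoc, hA]
  | hadd A B hA hB => rw [map_add, mul_add, add_mul, hA, hB]
  | hsmul r A hA => rw [map_smul, mul_smul_comm, smul_mul_assoc, hA]

/-- The product distribution on pairs acting on the two halves. -/
def tens {n : ℕ} (A B : GroupAlg n) : GroupAlg (n + 1) := algL n A * algR n B

theorem tens_mul_tens {n : ℕ} (A B C D : GroupAlg n) :
    tens A B * tens C D = tens (A * C) (B * D) := by
  simp only [tens, map_mul]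
  rw [mul_assoc, ← mul_assoc (algR n B), algR_mul_algL, mul_assoc, mul_assoc]

theorem swapEl_mul_tens {n : ℕ} (A B : GroupAlg n) :
    swapEl n * tens A B = tens B A * swapEl n := by
  rw [tens, tens, ← mul_assoc, swapEl_mul_algL, mul_assoc, swapEl_mul_algR, ← mul_assoc,
    algR_mul_algL]

theorem algL_eq_tens {n : ℕ} (A : GroupAlg n) : algL n A = tens A 1 := by
  rw [tens, map_one, mul_one]

theorem tens_mul_swapEl_mul_tens {n : ℕ} (A B C D : GroupAlg n) :
    tens A B * swapEl n * tens C D = tens (A * D) (B * C) * swapEl n := by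
  rw [mul_assoc, swapEl_mul_tens, ← mul_assoc, tens_mul_tens]

theorem tens_mul_swapEl_mul_tens_mul_swapEl {n : ℕ} (A B C D : GroupAlg n) :
    tens A B * swapEl n * (tens C D * swapEl n) = tens (A * D) (B * C) := by
  rw [← mul_assoc, tens_mul_swapEl_mul_tens, mul_assoc, swapEl_mul_self, mul_one]

theorem tens_mul_tens_mul_swapEl {n : ℕ} (A B C D : GroupAlg n) :
    tens A B * (tens C D * swapEl n) = tens (A * C) (B * D) * swapEl n := by
  rw [← mul_assoc, tens_mul_tens]

/-- The distributions of the permutations that correspond to the four factor types: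
for `n ≥ 2`, `ss` and `nn` are uniform on the two cosets of a subgroup of the group generated by `x_n` and the
`v_i`, and all four are uniform on the cosets of this subgroup in the group that is generated
in addition by `a_n`. -/
def dist : (n : ℕ) → FactorType → GroupAlg n
  | 0, _ => 1
  | n + 1, .ss => (1 / 2 : ℚ) • (tens (dist n .ss) (dist n .ss) + tens (dist n .nn) (dist n .nn))
  | n + 1, .nn => (1 / 2 : ℚ) • ((tens (dist n .nn) (dist n .ss) +
      tens (dist n .ss) (dist n .nn)) * swapEl n)
  | n + 1, .ns => (1 / 2 : ℚ) • ((tens (dist n .ss) (dist n .ss) +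
      tens (dist n .nn) (dist n .nn)) * swapEl n)
  | n + 1, .sn => (1 / 2 : ℚ) • (tens (dist n .nn) (dist n .ss) + tens (dist n .ss) (dist n .nn))

/-- The multiplication table of Z/2. The induction closes because `ss` and `nn` at level n + 1
involve only `ss` and `nn` at level n. -/
theorem dist_mul_dist_index_two (n : ℕ) :
    dist n .ss * dist n .ss = dist n .ss ∧ dist n .ss * dist n .nn = dist n .nn ∧
      dist n .nn * dist n .ss = dist n .nn ∧ dist n .nn * dist n .nn = dist n .ss := by
  induction n with
  | zero => simp [dist]
  | succ n ih =>
    obtain ⟨h1, h2, h3, h4⟩ := ih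
    refine ⟨?_, ?_, ?_, ?_⟩ <;>
    · simp only [dist, smul_mul_smul_comm, mul_add, add_mul, tens_mul_tens,
        tens_mul_tens_mul_swapEl, tens_mul_swapEl_mul_tens, tens_mul_swapEl_mul_tens_mul_swapEl,
        h1, h2, h3, h4]
      module

theorem dist_ns_mul_self (n : ℕ) : dist n .ns * dist n .ns = dist n .ss := by
  cases n with
  | zero => simp [dist]
  | succ n =>
    obtain ⟨h1, h2, h3, h4⟩ := dist_mul_dist_index_two n
    simp only [dist, smul_mul_smul_comm, mul_add, add_mul, tens_mul_swapEl_mul_tens_mul_swapEl,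
      h1, h2, h3, h4]
    module

theorem dist_sn_mul_self (n : ℕ) : dist n .sn * dist n .sn = dist n .ss := by
  cases n with
  | zero => simp [dist]
  | succ n =>
    obtain ⟨h1, h2, h3, h4⟩ := dist_mul_dist_index_two n
    simp only [dist, smul_mul_smul_comm, mul_add, add_mul, tens_mul_tens, h1, h2, h3, h4]
    module

/-! ### Translation by the generators -/

theorem el_x_top (n : ℕ) : el (x (n + 1) (n + 1)) = tens (el (x n n)) 1 * swapEl n := by
  rw [x_top, el, map_mul, ← algL_eq_tens, algL_el]; rfl

/-- By x_{n+1} = (x_n, 1) · exchange, one coordinate changes between `ss` and `nn` and the exchange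
factor is toggled. -/
theorem el_x_mul_dist (n : ℕ) :
    el (x n n) * dist n .ss = dist n .nn ∧ el (x n n) * dist n .nn = dist n .ss ∧
      el (x n n) * dist n .ns = dist n .sn ∧ el (x n n) * dist n .sn = dist n .ns := by
  induction n with
  | zero => simp [dist, x, el_one, -MonoidAlgebra.of_apply]
  | succ n ih =>
    obtain ⟨h1, h2, -, -⟩ := ih
    refine ⟨?_, ?_, ?_, ?_⟩ <;>
      simp only [el_x_top, dist, mul_smul_comm, mul_add, add_mul,
        tens_mul_swapEl_mul_tens, tens_mul_swapEl_mul_tens_mul_swapEl, h1, h2, one_mul] <;>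
      module

/-- No induction is needed: a_n is the exchange itself, and the sums in `dist` are symmetric in the
two halves. -/
theorem el_a_mul_dist (n : ℕ) :
    el (a n n) * dist n .ss = dist n .ns ∧ el (a n n) * dist n .ns = dist n .ss ∧
      el (a n n) * dist n .nn = dist n .sn ∧ el (a n n) * dist n .sn = dist n .nn := by
  cases n with
  | zero => simp [dist, a, el_one, -MonoidAlgebra.of_apply]
  | succ n =>
    have h : el (a (n + 1) (n + 1)) = swapEl n := rfl
    have h' (A B : GroupAlg n) : swapEl n * (tens A B * swapEl n) = tens B A := by
      rw [← mul_assoc, swapEl_mul_tens, mul_assoc, swapEl_mul_self, mul_one]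
    refine ⟨?_, ?_, ?_, ?_⟩ <;>
      simp only [h, h', dist, mul_smul_comm, mul_add, add_mul, swapEl_mul_tens] <;>
      module

/-- The last v_i is x_n², and x_n acts as an involution on the four distributions. An earlier v_i
acts on the left half only, where recursion applies. -/
theorem el_v_mul_dist {n i : ℕ} (hi : i + 2 ≤ n) (t : FactorType) :
    el (v n i) * dist n t = dist n t := by
  obtain ⟨n, rfl⟩ : ∃ k, n = k + 1 := ⟨n - 1, by omega⟩
  rcases Nat.lt_or_ge n (i + 2) with h | h
  · obtain rfl : n = i + 1 := by omega
    obtain ⟨h1, h2, h3, h4⟩ := el_x_mul_dist (i + 2)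
    rw [v, el, map_pow, sq, mul_assoc]
    cases t <;> simp only [h1, h2, h3, h4]
  · have hss := el_v_mul_dist h .ss
    have hnn := el_v_mul_dist h .nn
    rw [v_succ h, ← algL_el, algL_eq_tens]
    cases t <;>
      simp only [dist, mul_smul_comm, mul_add, add_mul, tens_mul_tens, tens_mul_tens_mul_swapEl,
        hss, hnn, one_mul]

/-- The uniform distribution on `M_{n+1}`. -/
def distM (n : ℕ) : GroupAlg (n + 1) :=
  (1 / 8 : ℚ) • (tens (dist n .nn) (dist n .nn) + tens (dist n .ss) (dist n .ss) +
      tens (dist n .ns) (dist n .sn) + tens (dist n .sn) (dist n .ns)) +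
    (1 / 8 : ℚ) • ((tens (dist n .ss) (dist n .nn) + tens (dist n .nn) (dist n .ss) +
      tens (dist n .ns) (dist n .ns) + tens (dist n .sn) (dist n .sn)) * swapEl n)

theorem el_x_mul_distM (n : ℕ) : el (x (n + 1) (n + 1)) * distM n = distM n := by
  obtain ⟨h1, h2, h3, h4⟩ := el_x_mul_dist n
  simp only [el_x_top, distM, mul_smul_comm, mul_add, add_mul, tens_mul_swapEl_mul_tens,
    tens_mul_swapEl_mul_tens_mul_swapEl, h1, h2, h3, h4, one_mul]
  module

theorem el_m_eq (n : ℕ) : el (m (n + 1)) = tens (el (a n n)) (el (x n n) * el (a n n)) := by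
  rw [m_succ, ← el_mul (x n n), tens, algL_el, algR_el, ← el_mul]

theorem el_m_mul_distM (n : ℕ) : el (m (n + 1)) * distM n = distM n := by
  obtain ⟨h1, h2, h3, h4⟩ := el_x_mul_dist n
  obtain ⟨k1, k2, k3, k4⟩ := el_a_mul_dist n
  simp only [el_m_eq, distM, mul_smul_comm, mul_add, add_mul, tens_mul_tens,
    tens_mul_tens_mul_swapEl, mul_assoc (el (x n n)), h1, h2, h3, h4, k1, k2, k3, k4]
  module

theorem el_v_mul_distM {n i : ℕ} (hi : i + 3 ≤ n + 1) : el (v (n + 1) i) * distM n = distM n := by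
  have h := fun t => el_v_mul_dist (n := n) (i := i) (by omega) t
  rw [v_succ (by omega), ← algL_el, algL_eq_tens]
  simp only [distM, mul_smul_comm, mul_add, add_mul, tens_mul_tens,
    tens_mul_tens_mul_swapEl, h, one_mul]

theorem el_mul_distM {n : ℕ} {g : Perm (Fin (2 ^ (n + 1)))} (hg : g ∈ M (n + 1)) :
    el g * distM n = distM n := by
  induction hg using Subgroup.closure_induction with
  | mem g hg =>
    rcases hg with (rfl | rfl) | ⟨i, hi, rfl⟩
    exacts [el_x_mul_distM n, el_m_mul_distM n, el_v_mul_distM hi]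
  | one => rw [el, map_one, one_mul]
  | mul g h _ _ hg hh => rw [el, map_mul, mul_assoc, hh, hg]
  | inv g _ hg =>
    conv_lhs => rw [← hg]
    rw [← mul_assoc, el, el, ← map_mul, inv_mul_cancel, map_one, one_mul]

/-! ### Supports -/

/-- The subalgebra of elements supported in a subgroup. -/
def supportedIn {n : ℕ} (H : Subgroup (Perm (Fin (2 ^ n)))) : Subalgebra ℚ (GroupAlg n) :=
  (MonoidAlgebra.mapDomainAlgHom ℚ ℚ H.subtype).range

theorem el_mem_supportedIn {n : ℕ} {H : Subgroup (Perm (Fin (2 ^ n)))} {g : Perm (Fin (2 ^ n))}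
    (hg : g ∈ H) : el g ∈ supportedIn H :=
  ⟨MonoidAlgebra.of ℚ H ⟨g, hg⟩, by simp [el]⟩

theorem coeff_eq_zero_of_mem_supportedIn {n : ℕ} {H : Subgroup (Perm (Fin (2 ^ n)))}
    {A : GroupAlg n} (hA : A ∈ supportedIn H) {g : Perm (Fin (2 ^ n))} (hg : g ∉ H) :
    A.coeff g = 0 := by
  obtain ⟨B, rfl⟩ := hA
  exact Finsupp.mapDomain_of_notMem_range _ _ (by simpa using hg)

theorem supportedIn_le {n : ℕ} {H : Subgroup (Perm (Fin (2 ^ n)))}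
    {S : Subalgebra ℚ (GroupAlg n)} (h : ∀ g ∈ H, el g ∈ S) : supportedIn H ≤ S := by
  rintro _ ⟨B, rfl⟩
  change MonoidAlgebra.mapDomainAlgHom ℚ ℚ H.subtype B ∈ S
  induction B using MonoidAlgebra.induction_on with
  | of g => simpa [el] using h g g.2
  | add A B hA hB => rw [map_add]; exact add_mem hA hB
  | smul r A hA => rw [map_smul]; exact Subalgebra.smul_mem _ hA r

theorem map_mem_supportedIn {n k : ℕ} {φ : Perm (Fin (2 ^ n)) →* Perm (Fin (2 ^ k))}
    {H : Subgroup (Perm (Fin (2 ^ k)))} {A : GroupAlg n} (hA : A ∈ supportedIn (H.comap φ)) :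
    MonoidAlgebra.mapDomainAlgHom ℚ ℚ φ A ∈ supportedIn H :=
  supportedIn_le (S := (supportedIn H).comap (MonoidAlgebra.mapDomainAlgHom ℚ ℚ φ))
    (fun g hg => by simpa [el] using el_mem_supportedIn (H := H) (g := φ g) hg) hA

theorem supportedIn_mono {n : ℕ} {H K : Subgroup (Perm (Fin (2 ^ n)))} (h : H ≤ K) :
    supportedIn H ≤ supportedIn K :=
  supportedIn_le fun _ hg => el_mem_supportedIn (h hg)

theorem tens_dist_nn (n : ℕ) : tens (dist n .nn) (dist n .nn) =
    el (inL n (x n n) * inR n (x n n)) * tens (dist n .ss) (dist n .ss) := by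
  rw [el_mul, ← algL_el, ← algR_el, ← tens, tens_mul_tens, (el_x_mul_dist n).1]

/-- The inductive step for `dist_ss_mem_supportedIn`, in a form that also applies to `M_{n+1}`. -/
theorem tens_dist_ss_mem_supportedIn {n : ℕ}
    (ih : ∀ (H : Subgroup (Perm (Fin (2 ^ n)))) (_ : ∀ i, i + 2 ≤ n → v n i ∈ H)
      (_ : ∀ g ∈ H, x n n * g * (x n n)⁻¹ ∈ H), dist n .ss ∈ supportedIn H)
    (H : Subgroup (Perm (Fin (2 ^ (n + 1))))) (hxx : inL n (x n n) * inR n (x n n) ∈ H)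
    (hv : ∀ i, i + 2 ≤ n → inL n (v n i) ∈ H)
    (hx : ∀ g ∈ H, x (n + 1) (n + 1) * g * (x (n + 1) (n + 1))⁻¹ ∈ H) :
    tens (dist n .ss) (dist n .ss) ∈ supportedIn H := by
  -- Conjugation by x_{n+1} carries the left copy of g to the right copy.
  have hLR : H.comap (inL n) ≤ H.comap (inR n) := by
    intro g hg
    have := hx _ hg
    rwa [x_top_mul_inL, mul_inv_cancel_right] at this
  -- Conjugation by (x_n, x_n) ∈ H shows that the left-half part of H is normalized by x_n.
  have hss : dist n .ss ∈ supportedIn (H.comap (inL n)) := by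
    refine ih _ hv fun g hg => ?_
    have := mul_mem (mul_mem hxx hg) (inv_mem hxx)
    rw [Subgroup.mem_comap]
    convert this using 1
    rw [map_mul, map_mul, map_inv, mul_inv_rev, mul_assoc (inL n (x n n)) (inR n _), inR_mul_inL]
    group
  exact mul_mem (map_mem_supportedIn hss) (map_mem_supportedIn (supportedIn_mono hLR hss))

/-- A subgroup that contains the `v_i` and is normalized by `x_n` supports `dist n ss`. -/
theorem dist_ss_mem_supportedIn (n : ℕ) :
    ∀ (H : Subgroup (Perm (Fin (2 ^ n)))) (_ : ∀ i, i + 2 ≤ n → v n i ∈ H)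
      (_ : ∀ g ∈ H, x n n * g * (x n n)⁻¹ ∈ H), dist n .ss ∈ supportedIn H := by
  induction n with
  | zero => intro H _ _; rw [dist]; exact one_mem _
  | succ n ih =>
    intro H hv hx
    -- This element is x_{n+1}², the last of the v_i, except at n = 0, where it is trivial and no
    -- v_i exists.
    have hxx : inL n (x n n) * inR n (x n n) ∈ H := by
      cases n with
      | zero => simp [x]
      | succ n => rw [← x_top_sq]; exact hv n le_rfl
    have hss := tens_dist_ss_mem_supportedIn ih H hxx
      (fun i hi => by rw [← v_succ hi]; exact hv i (by omega)) hx
    rw [dist, tens_dist_nn]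
    exact Subalgebra.smul_mem _ (add_mem hss (mul_mem (el_mem_supportedIn hxx) hss)) _

/-- Starting from `ss` on both halves, multiplication by x_{n+1}² and m_{n+1} produces the other
summands without exchange; x_{n+1} then carries their sum to the part with exchange. The square
x_{n+1}² replaces the v_i absent from the generators. -/
theorem distM_mem_supportedIn (n : ℕ) : distM n ∈ supportedIn (M (n + 1)) := by
  have hx : x (n + 1) (n + 1) ∈ M (n + 1) := Subgroup.subset_closure (by simp)
  have hm : m (n + 1) ∈ M (n + 1) := Subgroup.subset_closure (by simp)
  have hxx : inL n (x n n) * inR n (x n n) ∈ M (n + 1) := by rw [← x_top_sq]; exact pow_mem hx 2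
  have hss := tens_dist_ss_mem_supportedIn (dist_ss_mem_supportedIn n) (M (n + 1)) hxx
    (fun i hi => by
      rw [← v_succ hi]; exact Subgroup.subset_closure (Or.inr ⟨i, by omega, rfl⟩))
    (fun g hg => mul_mem (mul_mem hx hg) (inv_mem hx))
  obtain ⟨h1, h2, h3, h4⟩ := el_x_mul_dist n
  obtain ⟨k1, k2, k3, k4⟩ := el_a_mul_dist n
  have hnn : tens (dist n .nn) (dist n .nn) ∈ supportedIn (M (n + 1)) := by
    rw [tens_dist_nn]; exact mul_mem (el_mem_supportedIn hxx) hss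
  have hns : tens (dist n .ns) (dist n .sn) ∈ supportedIn (M (n + 1)) := by
    have := mul_mem (el_mem_supportedIn hm) hss
    rwa [el_m_eq, tens_mul_tens, mul_assoc, k1, h3] at this
  have hsn : tens (dist n .sn) (dist n .ns) ∈ supportedIn (M (n + 1)) := by
    have := mul_mem (el_mem_supportedIn hxx) hns
    rwa [el_mul, ← algL_el, ← algR_el, ← tens, tens_mul_tens, h3, h4] at this
  have hsum := add_mem (add_mem (add_mem hnn hss) hns) hsn
  refine add_mem (Subalgebra.smul_mem _ hsum _) (Subalgebra.smul_mem _ ?_ _)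
  have := mul_mem (el_mem_supportedIn hx) hsum
  simp only [el_x_top, mul_add, tens_mul_swapEl_mul_tens, h1, h2, h3, h4, one_mul] at this
  simpa only [add_mul] using this

/-! ### Generating functions of cycle types -/

/-- Formal rational combinations of partitions; the product is the union of partitions. -/
abbrev CycleAlg := AddMonoidAlgebra ℚ (Multiset ℕ)

/-- The distribution of the cycle type under a distribution of permutations. -/
def cyc {n : ℕ} : GroupAlg n →ₗ[ℚ] CycleAlg where
  toFun A := .ofCoeff (A.coeff.mapDomain cycles)
  map_add' A B := by simp [Finsupp.mapDomain_add]
  map_smul' r A := by simp [Finsupp.mapDomain_smul]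

theorem cyc_el {n : ℕ} (g : Perm (Fin (2 ^ n))) : cyc (el g) = .single (cycles g) 1 := by
  simp [cyc, el]

theorem coeff_cyc {n : ℕ} (A : GroupAlg n) (c : Multiset ℕ) :
    (cyc A).coeff c = ∑ g with cycles g = c, A.coeff g := by
  change A.coeff.mapDomain cycles c = _
  rw [Finsupp.mapDomain, Finsupp.sum_fintype _ _ (by simp), Finsupp.finsetSum_apply,
    Finset.sum_filter]
  simp only [Finsupp.single_apply]

/-- Multiplication of all parts by `d`. -/
def scale (d : ℕ) : CycleAlg →ₐ[ℚ] CycleAlg :=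
  AddMonoidAlgebra.mapDomainAlgHom ℚ ℚ (Multiset.mapAddMonoidHom (d * ·))

theorem scale_single (d : ℕ) (c : Multiset ℕ) (r : ℚ) :
    scale d (.single c r) = .single (c.map (d * ·)) r := by
  simp [scale]

theorem scale_scale (d e : ℕ) (A : CycleAlg) : scale d (scale e A) = scale (e * d) A := by
  induction A using AddMonoidAlgebra.induction_linear with
  | zero => simp
  | add A B hA hB => simp only [map_add, hA, hB]
  | single c r => simp [scale_single, Multiset.map_map, mul_comm e d, mul_assoc]

theorem scale_one (A : CycleAlg) : scale 1 A = A := by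
  induction A using AddMonoidAlgebra.induction_linear with
  | zero => simp
  | add A B hA hB => simp only [map_add, hA, hB]
  | single c r => simp [scale_single]

theorem tens_el_el {n : ℕ} (g h : Perm (Fin (2 ^ n))) :
    tens (el g) (el h) = el (inL n g * inR n h) := by
  rw [tens, algL_el, algR_el, el_mul]

theorem cyc_tens {n : ℕ} (A B : GroupAlg n) : cyc (tens A B) = cyc A * cyc B := by
  induction A using groupAlg_induction with
  | hel g =>
    induction B using groupAlg_induction with
    | hel h =>
      rw [tens_el_el, cyc_el, cyc_el, cyc_el, cycles_inL_mul_inR,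
        AddMonoidAlgebra.single_mul_single, one_mul]
    | hadd A B hA hB => simp only [tens, map_add, mul_add] at *; rw [hA, hB]
    | hsmul r A hA => simp only [tens, map_smul, mul_smul_comm] at *; rw [hA]
  | hadd A C hA hC => simp only [tens, map_add, add_mul] at *; rw [hA, hC]
  | hsmul r A hA => simp only [tens, map_smul, smul_mul_assoc] at *; rw [hA]

/-- Bilinear extension of `cycles_inL_mul_inR_mul_a_top`; only the product distribution `A * B`
matters, which is why the Z/2 table gives closed recursions. -/
theorem cyc_tens_mul_swapEl {n : ℕ} (A B : GroupAlg n) :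
    cyc (tens A B * swapEl n) = scale 2 (cyc (A * B)) := by
  induction A using groupAlg_induction with
  | hel g =>
    induction B using groupAlg_induction with
    | hel h =>
      rw [tens_el_el, swapEl, ← el_mul, ← el_mul, cyc_el, cyc_el, cycles_inL_mul_inR_mul_a_top,
        scale_single]
    | hadd A B hA hB => simp only [tens, map_add, mul_add, add_mul] at *; rw [hA, hB]
    | hsmul r A hA =>
      simp only [tens, map_smul, mul_smul_comm, smul_mul_assoc] at *; rw [hA]
  | hadd A C hA hC => simp only [tens, map_add, add_mul] at *; rw [hA, hC]
  | hsmul r A hA => simp only [tens, map_smul, smul_mul_assoc] at *; rw [hA]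

theorem cyc_dist_succ_nn (n : ℕ) : cyc (dist (n + 1) .nn) = scale 2 (cyc (dist n .nn)) := by
  obtain ⟨h1, h2, h3, h4⟩ := dist_mul_dist_index_two n
  simp only [dist, map_smul, map_add, add_mul, cyc_tens_mul_swapEl, h2, h3]
  module

theorem cyc_dist_succ_ns (n : ℕ) : cyc (dist (n + 1) .ns) = scale 2 (cyc (dist n .ss)) := by
  obtain ⟨h1, h2, h3, h4⟩ := dist_mul_dist_index_two n
  simp only [dist, map_smul, map_add, add_mul, cyc_tens_mul_swapEl, h1, h4]
  module

theorem cyc_dist_succ_sn (n : ℕ) :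
    cyc (dist (n + 1) .sn) = cyc (dist n .nn) * cyc (dist n .ss) := by
  simp only [dist, map_smul, map_add, cyc_tens, mul_comm (cyc (dist n .ss))]
  module

theorem cyc_dist_succ_ss (n : ℕ) :
    cyc (dist (n + 1) .ss) = (1 / 2 : ℚ) • (cyc (dist n .nn) * cyc (dist n .nn)) +
      (1 / 2 : ℚ) • (cyc (dist n .ss) * cyc (dist n .ss)) := by
  simp only [dist, map_smul, map_add, cyc_tens]
  module

/-- The right-hand side has the shape of `levelOne`. In the exchange part, the products `ss · nn`
and `nn · ss` give `nn`, while `ns²` and `sn²` give `ss`. -/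
theorem cyc_distM (n : ℕ) :
    cyc (distM n) = (1 / 4 : ℚ) • scale 2 (cyc (dist n .nn)) +
      (1 / 4 : ℚ) • scale 2 (cyc (dist n .ss)) +
      (1 / 8 : ℚ) • (cyc (dist n .nn) * cyc (dist n .nn)) +
      (1 / 8 : ℚ) • (cyc (dist n .ss) * cyc (dist n .ss)) +
      (1 / 4 : ℚ) • (cyc (dist n .ns) * cyc (dist n .sn)) := by
  obtain ⟨h1, h2, h3, h4⟩ := dist_mul_dist_index_two n
  simp only [distM, map_smul, map_add, add_mul, cyc_tens, cyc_tens_mul_swapEl, h2, h3,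
    dist_ns_mul_self, dist_sn_mul_self, mul_comm (cyc (dist n .sn))]
  module

/-! ### The Markov process -/

/-- One application of the Markov process is a homomorphism of algebras. -/
def stepHom : LevelData →ₐ[ℚ] LevelData :=
  AddMonoidAlgebra.lift ℚ LevelData FormalProduct
    { toFun := fun F => (F.toAdd.map stepFactor).prod
      map_one' := by simp
      map_mul' := fun F G => by simp }

theorem step_eq_stepHom : step = stepHom := by
  funext D
  rw [stepHom, AddMonoidAlgebra.lift_apply]
  rfl

/-- The distribution of the underlying partition. -/
def degHom : LevelData →ₐ[ℚ] CycleAlg :=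
  AddMonoidAlgebra.mapDomainAlgHom ℚ ℚ (Multiset.mapAddMonoidHom Prod.snd)

/-- The distribution of the underlying partition after `k` applications of the process. -/
def evolve : ℕ → LevelData →ₐ[ℚ] CycleAlg
  | 0 => degHom
  | k + 1 => (evolve k).comp stepHom

/-- `evolve` peels off the first step, not the last, so that it matches the recursion of `dist` at
the root. -/
theorem evolve_apply (k : ℕ) (D : LevelData) : evolve k D = degHom (step^[k] D) := by
  induction k generalizing D with
  | zero => rfl
  | succ k ih =>
    rw [Function.iterate_succ_apply, ← ih, step_eq_stepHom]
    rfl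

/-- The datum of a single factor. -/
def factorDatum (f : Factor) : LevelData := .single {f} 1

theorem single_singleton (f : Factor) (r : ℚ) :
    (.single {f} r : LevelData) = r • factorDatum f := by
  simp [factorDatum]

theorem single_pair (f g : Factor) (r : ℚ) :
    (.single {f, g} r : LevelData) = r • (factorDatum f * factorDatum g) := by
  rw [factorDatum, factorDatum, AddMonoidAlgebra.single_mul_single, AddMonoidAlgebra.smul_single]
  simp

theorem stepHom_factorDatum (f : Factor) : stepHom (factorDatum f) = stepFactor f := by
  rw [← step_eq_stepHom, step, factorDatum, AddMonoidAlgebra.coeff_single,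
    Finsupp.sum_single_index (by exact zero_smul ℚ _), one_smul, Multiset.map_singleton,
    Multiset.prod_singleton]

theorem evolve_succ_factorDatum (k : ℕ) (f : Factor) :
    evolve (k + 1) (factorDatum f) = evolve k (stepFactor f) := by
  rw [evolve, AlgHom.comp_apply, stepHom_factorDatum]

/-- The dictionary between process and tree: a factor's first transition reflects the action at the
root of a tree of height k, and d only rescales cycle lengths. -/
theorem evolve_factorDatum (k : ℕ) (t : FactorType) (d : ℕ) :
    evolve k (factorDatum (t, d)) = scale d (cyc (dist k t)) := by
  induction k generalizing t d with
  | zero =>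
    have h : cycles (1 : Perm (Fin (2 ^ 0))) = {1} := by simp [cycles, Perm.parts_partition]
    rw [dist, ← el_one, cyc_el, h]
    simp [evolve, degHom, factorDatum, scale_single]
  | succ k ih =>
    rw [evolve_succ_factorDatum, stepFactor]
    cases t <;>
      simp [transitions, single_singleton, single_pair, ih, cyc_dist_succ_nn, cyc_dist_succ_ns,
        cyc_dist_succ_sn, cyc_dist_succ_ss, scale_scale, -Multiset.insert_eq_cons]

theorem degHom_levelData (k : ℕ) : degHom (levelData (k + 1)) = cyc (distM k) := by
  rw [levelData, Nat.add_sub_cancel, ← evolve_apply, levelOne, cyc_distM]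
  simp only [single_singleton, single_pair, map_smul, map_mul, map_add, evolve_factorDatum,
    scale_one]

theorem coeff_single_nonneg {r : ℚ} (hr : 0 ≤ r) (F G : FormalProduct) :
    0 ≤ (.single F r : LevelData).coeff G := by
  classical
  rw [AddMonoidAlgebra.coeff_single, Finsupp.single_apply]
  split_ifs
  exacts [hr, le_rfl]

/-- Collections of data with nonnegative densities. -/
def nonnegData : Subsemiring LevelData where
  carrier := {D | ∀ F, 0 ≤ D.coeff F}
  zero_mem' := fun _ => le_rfl
  one_mem' := coeff_single_nonneg zero_le_one 0
  add_mem' := fun hA hB F => add_nonneg (hA F) (hB F)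
  mul_mem' := fun {A B} hA hB F => by
    rw [AddMonoidAlgebra.mul_def, AddMonoidAlgebra.coeff_finsuppSum, Finsupp.sum_apply]
    refine Finset.sum_nonneg fun G _ => ?_
    simp only [AddMonoidAlgebra.coeff_finsuppSum, Finsupp.sum_apply]
    exact Finset.sum_nonneg fun G' _ => coeff_single_nonneg (mul_nonneg (hA G) (hB G')) _ _

theorem smul_mem_nonnegData {r : ℚ} (hr : 0 ≤ r) {D : LevelData} (hD : D ∈ nonnegData) :
    r • D ∈ nonnegData :=
  fun F => mul_nonneg hr (hD F)

theorem stepFactor_mem_nonnegData (f : Factor) : stepFactor f ∈ nonnegData := by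
  refine list_sum_mem fun D hD => ?_
  obtain ⟨F, -, rfl⟩ := List.mem_map.1 hD
  exact coeff_single_nonneg (by positivity) F

theorem step_mem_nonnegData {D : LevelData} (hD : D ∈ nonnegData) : step D ∈ nonnegData := by
  refine sum_mem fun F _ => smul_mem_nonnegData (hD F) (multiset_prod_mem _ fun E hE => ?_)
  obtain ⟨f, -, rfl⟩ := Multiset.mem_map.1 hE
  exact stepFactor_mem_nonnegData f

theorem levelData_mem_nonnegData (n : ℕ) : levelData n ∈ nonnegData := by
  rw [levelData]
  induction n - 1 with
  | zero =>
    refine add_mem (add_mem (add_mem (add_mem ?_ ?_) ?_) ?_) ?_ <;>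
      exact coeff_single_nonneg (by norm_num) _
  | succ k ih => rw [Function.iterate_succ_apply']; exact step_mem_nonnegData ih

theorem coeff_degHom (D : LevelData) (c : Multiset ℕ) :
    (degHom D).coeff c = ∑ G ∈ D.coeff.support with degrees G = c, D.coeff G := by
  change D.coeff.mapDomain degrees c = _
  rw [Finsupp.mapDomain, Finsupp.sum_apply, Finsupp.sum, Finset.sum_filter]
  simp only [Finsupp.single_apply]

/-- The pairs of an index and its nonzero coefficient. -/
def coeffGraph (A : CycleAlg) : Set (Multiset ℕ × ℚ) :=
  {p | A.coeff p.1 ≠ 0 ∧ p.2 = A.coeff p.1}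

/-- Nonnegativity excludes cancellation, so a partition occurring in some datum has nonzero total
density. -/
theorem toCycleData_eq_coeffGraph {D : LevelData} (hD : D ∈ nonnegData) :
    D.toCycleData = coeffGraph (degHom D) := by
  ext ⟨c, q⟩
  simp only [LevelData.toCycleData, coeffGraph, Set.mem_ofPred_eq]
  constructor
  · rintro ⟨F, hF, rfl, rfl⟩
    rw [coeff_degHom]
    refine ⟨ne_of_gt (Finset.sum_pos' (fun G _ => hD G) ⟨F, by simpa using hF, ?_⟩), rfl⟩
    exact lt_of_le_of_ne (hD F) (Finsupp.mem_support_iff.1 hF).symm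
  · rintro ⟨h, rfl⟩
    rw [coeff_degHom] at h
    obtain ⟨F, hF, -⟩ := Finset.exists_ne_zero_of_sum_ne_zero h
    rw [Finset.mem_filter] at hF
    obtain ⟨hF, rfl⟩ := hF
    exact ⟨F, hF, rfl, coeff_degHom _ _⟩

/-! ### Uniformity -/

/-- The total mass of a distribution. -/
def mass (n : ℕ) : GroupAlg n →ₐ[ℚ] ℚ := MonoidAlgebra.lift ℚ ℚ _ 1

theorem mass_el {n : ℕ} (g : Perm (Fin (2 ^ n))) : mass n (el g) = 1 := by simp [mass, el]

theorem mass_apply {n : ℕ} (A : GroupAlg n) : mass n A = ∑ g, A.coeff g := by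
  rw [mass, MonoidAlgebra.lift_apply, Finsupp.sum_fintype _ _ (by simp)]
  simp

theorem mass_algL {n : ℕ} (A : GroupAlg n) : mass (n + 1) (algL n A) = mass n A := by
  induction A using groupAlg_induction with
  | hel g => rw [algL_el, mass_el, mass_el]
  | hadd A B hA hB => simp only [map_add, hA, hB]
  | hsmul r A hA => simp only [map_smul, hA]

theorem mass_algR {n : ℕ} (A : GroupAlg n) : mass (n + 1) (algR n A) = mass n A := by
  induction A using groupAlg_induction with
  | hel g => rw [algR_el, mass_el, mass_el]
  | hadd A B hA hB => simp only [map_add, hA, hB]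
  | hsmul r A hA => simp only [map_smul, hA]

theorem mass_tens {n : ℕ} (A B : GroupAlg n) :
    mass (n + 1) (tens A B) = mass n A * mass n B := by
  rw [tens, map_mul, mass_algL, mass_algR]

theorem mass_swapEl (n : ℕ) : mass (n + 1) (swapEl n) = 1 := mass_el _

theorem mass_dist (n : ℕ) (t : FactorType) : mass n (dist n t) = 1 := by
  induction n generalizing t with
  | zero => rw [dist, map_one]
  | succ n ih =>
    cases t <;> simp only [dist, map_smul, map_add, map_mul, mass_tens, mass_swapEl, ih] <;>
      norm_num

theorem mass_distM (n : ℕ) : mass (n + 1) (distM n) = 1 := by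
  simp only [distM, map_smul, map_add, map_mul, mass_tens, mass_swapEl, mass_dist]
  norm_num

-- Left invariance makes the coefficients constant on M_{n+1}, the support makes them vanish
-- elsewhere, and mass 1 fixes the constant.
open scoped Classical in
theorem coeff_distM (n : ℕ) (g : Perm (Fin (2 ^ (n + 1)))) :
    (distM n).coeff g =
      if g ∈ M (n + 1) then ((M (n + 1) : Set (Perm (Fin (2 ^ (n + 1))))).ncard : ℚ)⁻¹ else 0 := by
  have hconst : ∀ g, (distM n).coeff g = if g ∈ M (n + 1) then (distM n).coeff 1 else 0 := by
    intro g
    split_ifs with hg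
    -- The coefficient at g of the translate by g is the original coefficient at 1.
    · conv_lhs => rw [← el_mul_distM hg]
      rw [el, MonoidAlgebra.of_apply]
      simp
    · exact coeff_eq_zero_of_mem_supportedIn (distM_mem_supportedIn n) hg
  have hsum := mass_distM n
  rw [mass_apply, Finset.sum_congr rfl fun g _ => hconst g, ← Finset.sum_filter,
    Finset.sum_const, nsmul_eq_mul] at hsum
  have hcard : (M (n + 1) : Set (Perm (Fin (2 ^ (n + 1))))).ncard =
      (Finset.univ.filter (· ∈ M (n + 1))).card := by
    rw [← Set.ncard_coe_finset]; simp
  rw [hconst, hcard, eq_inv_of_mul_eq_one_right hsum]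

theorem coeff_cyc_distM (n : ℕ) (c : Multiset ℕ) :
    (cyc (distM n)).coeff c =
      ({h ∈ (M (n + 1) : Set (Perm (Fin (2 ^ (n + 1))))) | cycles h = c}.ncard : ℚ) /
        (M (n + 1) : Set (Perm (Fin (2 ^ (n + 1))))).ncard := by
  classical
  rw [coeff_cyc, Finset.sum_congr rfl fun g _ => coeff_distM n g, ← Finset.sum_filter,
    Finset.sum_const, nsmul_eq_mul, div_eq_mul_inv, ← Set.ncard_coe_finset]
  congr 3
  ext g
  simp [and_comm]

theorem cycleData_M_eq_coeffGraph (n : ℕ) :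
    cycleData (n := n + 1) (M (n + 1)) (M (n + 1)) = coeffGraph (cyc (distM n)) := by
  have hM : ((M (n + 1) : Set (Perm (Fin (2 ^ (n + 1))))).ncard : ℚ) ≠ 0 := by
    exact_mod_cast ((Set.ncard_pos (Set.toFinite _)).2 ⟨1, one_mem (M (n + 1))⟩).ne'
  ext ⟨c, q⟩
  simp only [cycleData, coeffGraph, Set.mem_ofPred_eq, coeff_cyc_distM, div_self hM, mul_one]
  constructor
  · rintro ⟨g, hg, rfl, rfl⟩
    refine ⟨div_ne_zero ?_ hM, rfl⟩
    rw [Nat.cast_ne_zero]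
    exact Set.ncard_ne_zero_of_mem (a := g) ⟨hg, rfl⟩ (Set.toFinite _)
  · rintro ⟨h, rfl⟩
    obtain ⟨g, hg, rfl⟩ := Set.nonempty_of_ncard_ne_zero
      (fun h0 => h (by rw [h0, Nat.cast_zero, zero_div]))
    exact ⟨g, hg, rfl, rfl⟩

end

end MarkovModel

/-- The first conjunct records that M_n, defined inside the full symmetric group, lies in W_n. -/
theorem theoremB (n : ℕ) (hn : 1 ≤ n) :
    MarkovModel.M n ≤ MarkovModel.treeAut n ∧
      MarkovModel.cycleData (n := n) (MarkovModel.M n) (MarkovModel.M n) =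
        MarkovModel.LevelData.toCycleData (MarkovModel.levelData n) := by
  obtain ⟨k, rfl⟩ : ∃ k, n = k + 1 := ⟨n - 1, by omega⟩
  refine ⟨MarkovModel.M_le_treeAut _, ?_⟩
  rw [MarkovModel.cycleData_M_eq_coeffGraph,
    MarkovModel.toCycleData_eq_coeffGraph (MarkovModel.levelData_mem_nonnegData _),
    MarkovModel.degHom_levelData]
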